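/- For an integer $n>0$ that is not a perfect square, let $h(n)$ denote the class number of the real quadratic field $\mathbb{Q}(\sqrt{n})$. Let $k \geq 1$ be an integer and let $M > 0$ be a real number. Then there exist infinitely many square-free integers $d > 0$ such that, for every $j = 1,\ldots,k$, the integer $jd$ is not a perfect square and $h(jd) > M$. More precisely, let $t \geq 0$ be an integer with $2^t > M$, let $p_1,\ldots,p_{t+2}$ be distinct prime numbers, all larger than $k$, and put $d = p_1 p_2\cdots p_{t+2}$. Then $d$ is square-free and, for every $j = 1,\ldots,k$, the integer $jd$ is not a perfect square, $2^t$ divides $h(jd)$, and $h(jd) > M$. -/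

import Mathlib

/-- The field `ℚ(√n)`, as a subfield of the real numbers; for `n` not a perfect square it is a
real quadratic field. -/
noncomputable abbrev realQuadField (n : ℕ) : IntermediateField ℚ ℝ :=
  IntermediateField.adjoin ℚ {Real.sqrt (n : ℝ)}

instance realQuadField_numberField (n : ℕ) : NumberField (realQuadField n) where
  to_charZero := inferInstance
  to_finiteDimensional := by
    apply IntermediateField.adjoin.finiteDimensional
    refine ⟨Polynomial.X ^ 2 - Polynomial.C (n : ℚ),
      Polynomial.monic_X_pow_sub_C _ two_ne_zero, ?_⟩
    simp

/-- `h(n)`: the class number of `ℚ(√n)`. -/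
noncomputable def quadClassNumber (n : ℕ) : ℕ :=
  NumberField.classNumber (realQuadField n)

/-!
Write `m` for the product of the primes and `n = jm`. For `d ∣ m`, `d` is coprime to `n / d`, so the
ideal `(d, √n)` has square `(d)` and its class lies in the 2-torsion of the class group. If `d` and
`e` give the same class, then `u d e` is a square in `ℚ(√n)` for some positive unit `u`. By
Dirichlet's unit theorem the positive units form at most two classes modulo squares, and each
square class of `ℚ(√n)` contains at most two squarefree positive integers. Hence the `2 ^ (t + 2)`
divisors of `m` give at least `2 ^ t` classes in the 2-torsion, whose order is a power of two
dividing the class number.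
-/

open Finset IntermediateField NumberField nonZeroDivisors

theorem isSquare_mul_of_isSquare_mul_left {G₀ : Type*} [CommGroupWithZero G₀] {c a b : G₀}
    (hc : c ≠ 0) (ha : IsSquare (c * a)) (hb : IsSquare (c * b)) : IsSquare (a * b) := by
  have h : a * b = c * a * (c * b) / (c * c) := by
    rw [mul_mul_mul_comm, mul_div_cancel_left₀ _ (mul_ne_zero hc hc)]
  exact h ▸ (ha.mul hb).div (.mul_self c)

theorem dvd_of_isSquare_mul_of_squarefree {R : Type*} [CommMonoidWithZero R]
    [IsCancelMulZero R] [DecompositionMonoid R] {a b : R} (ha : Squarefree a)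
    (h : IsSquare (a * b)) : a ∣ b := by
  obtain ⟨r, hr⟩ := h
  have har : a ∣ r := (ha.dvd_pow_iff_dvd two_ne_zero).1 ⟨b, by rw [pow_two, hr]⟩
  exact har.trans (ha.dvd_of_squarefree_of_mul_dvd_mul_right hr.symm.dvd)

theorem eq_of_isSquare_mul_of_squarefree {a b : ℕ} (ha : Squarefree a) (hb : Squarefree b)
    (h : IsSquare (a * b)) : a = b :=
  (dvd_of_isSquare_mul_of_squarefree ha h).antisymm
    (dvd_of_isSquare_mul_of_squarefree hb (mul_comm a b ▸ h))

theorem not_isSquare_mul_of_coprime_of_squarefree {c m : ℕ} (hm : Squarefree m) (hm1 : m ≠ 1)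
    (hcm : c.Coprime m) : ¬ IsSquare (c * m) := fun h =>
  hm1 <| Nat.eq_one_of_dvd_coprimes hcm
    (dvd_of_isSquare_mul_of_squarefree hm (mul_comm c m ▸ h)) dvd_rfl

theorem squarefree_prod_of_forall_prime {S : Finset ℕ} (hS : ∀ p ∈ S, p.Prime) :
    Squarefree (∏ p ∈ S, p) :=
  squarefree_prod_of_pairwise_isCoprime
    (fun p hp q hq hpq => Nat.coprime_iff_isRelPrime.1 <|
      (Nat.coprime_primes (hS p hp) (hS q hq)).2 hpq)
    fun p hp => (hS p hp).squarefree

theorem coprime_prod_of_forall_lt_prime {j : ℕ} {S : Finset ℕ} (hj : j ≠ 0)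
    (hS : ∀ p ∈ S, p.Prime ∧ j < p) : j.Coprime (∏ p ∈ S, p) :=
  .prod_right fun p hp => (Nat.coprime_of_lt_prime hj (hS p hp).2 (hS p hp).1).symm

theorem card_divisors_of_squarefree {m : ℕ} (hm : Squarefree m) :
    #m.divisors = 2 ^ #m.primeFactors := by
  rw [Nat.card_divisors hm.ne_zero]
  refine prod_eq_pow_card fun p hp => ?_
  have hp' := Nat.mem_primeFactors.1 hp
  rw [Nat.factorization_eq_one_of_squarefree hm hp'.1 hp'.2.1]

theorem exists_primes_gt (N r : ℕ) : ∃ S : Finset ℕ, #S = r ∧ ∀ p ∈ S, p.Prime ∧ N < p := by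
  obtain ⟨S, hS, hcard⟩ :=
    (Nat.infinite_setOfPred_prime.sdiff (Set.finite_Iic N)).exists_subset_card_eq r
  exact ⟨S, hcard, fun p hp => ⟨(hS hp).1, not_le.1 (hS hp).2⟩⟩

theorem pow_dvd_card_of_pow_le_card_ker {G : Type*} [CommGroup G] [Finite G] {p t : ℕ}
    [hp : Fact p.Prime] (h : p ^ t ≤ Nat.card (powMonoidHom p : G →* G).ker) :
    p ^ t ∣ Nat.card G := by
  have hpGroup : IsPGroup p (powMonoidHom p : G →* G).ker :=
    fun g => ⟨1, Subtype.ext <| by simpa using MonoidHom.mem_ker.1 g.2⟩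
  obtain ⟨s, hs⟩ := IsPGroup.iff_card.1 hpGroup
  rw [hs, Nat.pow_le_pow_iff_right hp.out.one_lt] at h
  exact ((pow_dvd_pow p h).trans hs.symm.dvd).trans (Subgroup.card_subgroup_dvd_card _)

theorem isSquare_prod_filter_odd_mul_prod_zpow {ι G : Type*} [Fintype ι] [CommGroup G]
    (η : ι → G) (e : ι → ℤ) : IsSquare ((∏ i with Odd (e i), η i) * ∏ i, η i ^ e i) := by
  rw [prod_filter, ← prod_mul_distrib]
  refine isSquare_prod _ fun i _ => ?_
  split_ifs with h
  · rw [← zpow_one_add]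
    exact (odd_one.add_odd h).isSquare_zpow _
  · rw [one_mul]
    exact (Int.not_odd_iff_even.1 h).isSquare_zpow _

theorem span_pair_sq_eq_span_singleton {R : Type*} [CommRing R] {a c θ : R}
    (hθ : θ ^ 2 = a * c) (hac : IsCoprime a c) :
    Ideal.span {a, θ} ^ 2 = Ideal.span {a} := by
  rw [pow_two, Ideal.span_pair_mul_span_pair]
  apply le_antisymm
  · simp only [Ideal.span_le, Set.insert_subset_iff, Set.singleton_subset_iff, SetLike.mem_coe,
      Ideal.mem_span_singleton, dvd_mul_right, dvd_mul_left, true_and]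
    exact ⟨c, by rw [← hθ, pow_two]⟩
  · obtain ⟨x, y, hxy⟩ := hac
    have ha : x * (a * a) + y * (θ * θ) = a := by
      linear_combination a * hxy + y * hθ
    rw [Ideal.span_singleton_le_iff_mem]
    refine (congrArg (· ∈ _) ha).mp (add_mem ?_ ?_) <;>
      exact Ideal.mul_mem_left _ _ (Ideal.subset_span (by simp))

theorem exists_unit_isSquare_of_mk0_eq {R : Type*} (K : Type*) [CommRing R] [IsDedekindDomain R]
    [Field K] [Algebra R K] [IsFractionRing R K] {I J : (Ideal R)⁰} {a b : R}
    (hI : (I : Ideal R) ^ 2 = Ideal.span {a}) (hJ : (J : Ideal R) ^ 2 = Ideal.span {b})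
    (h : ClassGroup.mk0 I = ClassGroup.mk0 J) :
    ∃ u : Rˣ, IsSquare (algebraMap R K (u * (a * b))) := by
  obtain ⟨x, y, -, hy, hxy⟩ := ClassGroup.mk0_eq_mk0_iff.1 h
  have hspan : Ideal.span {y ^ 2 * b} = Ideal.span {x ^ 2 * a} := by
    have hsq : (Ideal.span {y} * (J : Ideal R)) ^ 2 = (Ideal.span {x} * I) ^ 2 := by rw [hxy]
    rwa [mul_pow, mul_pow, hI, hJ, Ideal.span_singleton_pow, Ideal.span_singleton_pow,
      Ideal.span_singleton_mul_span_singleton, Ideal.span_singleton_mul_span_singleton] at hsq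
  obtain ⟨u, hu⟩ := Ideal.span_singleton_eq_span_singleton.1 hspan
  have huK := congrArg (algebraMap R K) hu
  have hyK : algebraMap R K y ≠ 0 := by simpa using hy
  refine ⟨u, algebraMap R K x * algebraMap R K a / algebraMap R K y, ?_⟩
  simp only [map_mul, map_pow] at huK ⊢
  field_simp
  linear_combination algebraMap R K a * huK

section RealEmbedding

variable {K : Type*} [Field K] [NumberField K]

theorem units_rank_lt_finrank : Units.rank K < Module.finrank ℚ K := by
  have hpos : 0 < Fintype.card (InfinitePlace K) := Fintype.card_pos
  rw [Units.rank, ← InfinitePlace.card_add_two_mul_card_eq_rank]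
  rw [InfinitePlace.card_eq_nrRealPlaces_add_nrComplexPlaces] at hpos ⊢
  omega

theorem torsion_eq_one_or_neg_one_of_real_embedding (φ : K →+* ℝ) {ζ : (𝓞 K)ˣ}
    (hζ : ζ ∈ Units.torsion K) : ζ = 1 ∨ ζ = -1 := by
  obtain ⟨m, hm, hζm⟩ := isOfFinOrder_iff_pow_eq_one.1 hζ
  have hpow : φ ζ ^ m = 1 := by
    rw [← map_pow, ← Units.coe_pow, hζm, Units.coe_one, map_one]
  have habs : |φ ζ| = 1 := by
    rw [← pow_eq_one_iff_of_nonneg (abs_nonneg _) hm.ne', ← abs_pow, hpow, abs_one]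
  refine (eq_or_eq_neg_of_abs_eq habs).imp (fun h => ?_) fun h => ?_ <;>
    exact Units.coe_injective K (φ.injective (by simpa using h))

theorem exists_eq_prod_fundSystem_or_eq_neg (φ : K →+* ℝ) (u : (𝓞 K)ˣ) :
    ∃ e : Fin (Units.rank K) → ℤ,
      u = ∏ i, Units.fundSystem K i ^ e i ∨ u = -∏ i, Units.fundSystem K i ^ e i := by
  obtain ⟨⟨ζ, e⟩, hu, -⟩ := Units.exist_unique_eq_mul_prod K u
  refine ⟨e, (torsion_eq_one_or_neg_one_of_real_embedding φ ζ.2).imp (fun h => ?_) fun h => ?_⟩ <;>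
    simp [hu, h]

theorem isSquare_of_isSquare_or_isSquare_neg (φ : K →+* ℝ) {u : (𝓞 K)ˣ} (hu : 0 < φ u)
    (h : IsSquare u ∨ IsSquare (-u)) : IsSquare u := by
  refine h.resolve_right ?_
  rintro ⟨v, hv⟩
  have : -φ u = φ v * φ v := by
    simpa using congrArg (fun w : (𝓞 K)ˣ => φ w) hv
  linarith [mul_self_nonneg (φ v)]

theorem exists_positive_units_isSquare_mul (φ : K →+* ℝ) :
    ∃ E : Finset (𝓞 K)ˣ, #E ≤ 2 ^ Units.rank K ∧
      ∀ u : (𝓞 K)ˣ, 0 < φ u → ∃ ε ∈ E, IsSquare (ε * u) := by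
  classical
  have hsign : ∀ v : (𝓞 K)ˣ, ∃ w : (𝓞 K)ˣ, 0 < φ w ∧ (w = v ∨ w = -v) := by
    intro v
    rcases lt_or_gt_of_ne ((map_ne_zero φ).2 (Units.coe_ne_zero v)) with h | h
    · exact ⟨-v, by simpa using h, .inr rfl⟩
    · exact ⟨v, h, .inl rfl⟩
  choose pos hpos hpos_eq using hsign
  let ε (s : Finset (Fin (Units.rank K))) : (𝓞 K)ˣ := pos (∏ i ∈ s, Units.fundSystem K i)
  refine ⟨univ.image ε, by simpa using card_image_le (s := univ) (f := ε), fun u hu => ?_⟩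
  obtain ⟨e, he⟩ := exists_eq_prod_fundSystem_or_eq_neg φ u
  have hsq := isSquare_prod_filter_odd_mul_prod_zpow (Units.fundSystem K) e
  let s : Finset (Fin (Units.rank K)) := {i | Odd (e i)}
  refine ⟨ε s, mem_image_of_mem _ (mem_univ _), isSquare_of_isSquare_or_isSquare_neg φ ?_ ?_⟩
  · simpa using mul_pos (hpos _) hu
  · rcases hpos_eq (∏ i ∈ s, Units.fundSystem K i) with hε | hε <;> rcases he with he | he <;>
      simp [ε, hε, he, s, hsq]

theorem card_le_of_mk0_eq (φ : K →+* ℝ) {D : Finset ℕ} {I : ℕ → (Ideal (𝓞 K))⁰} {b : ℕ}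
    (hD : ∀ d ∈ D, d ≠ 0) (hI : ∀ d ∈ D, (I d : Ideal (𝓞 K)) ^ 2 = Ideal.span {(d : 𝓞 K)})
    (hb : ∀ S ⊆ D, ∀ c : K, c ≠ 0 → (∀ d ∈ S, IsSquare (c * d)) → #S ≤ b)
    (hclass : ∀ d ∈ D, ∀ e ∈ D, ClassGroup.mk0 (I d) = ClassGroup.mk0 (I e)) :
    #D ≤ 2 ^ Units.rank K * b := by
  classical
  obtain rfl | ⟨a, ha⟩ := D.eq_empty_or_nonempty
  · simp
  obtain ⟨E, hEcard, hE⟩ := exists_positive_units_isSquare_mul φ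
  have hcover : D ⊆ E.biUnion fun ε => {d ∈ D | IsSquare ((ε : K) * a * d)} := by
    intro d hd
    obtain ⟨u, hu⟩ := exists_unit_isSquare_of_mk0_eq K (hI a ha) (hI d hd) (hclass a ha d hd)
    have husq : IsSquare ((u : K) * (a * d)) := by simpa using hu
    have hupos : 0 < φ u := by
      have hnonneg : 0 ≤ φ u * (a * d) := by simpa using (husq.map φ).nonneg
      have had : (0 : ℝ) < a * d := by
        exact_mod_cast Nat.pos_of_ne_zero (mul_ne_zero (hD a ha) (hD d hd))
      exact (nonneg_of_mul_nonneg_left hnonneg had).lt_of_ne'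
        ((map_ne_zero φ).2 (Units.coe_ne_zero u))
    obtain ⟨ε, hε, hεu⟩ := hE u hupos
    have hεK : IsSquare ((u : K) * ε) := by
      simpa [mul_comm] using (hεu.map (Units.coeHom (𝓞 K))).map (algebraMap (𝓞 K) K)
    simp only [mem_biUnion, mem_filter]
    refine ⟨ε, hε, hd, ?_⟩
    rw [mul_assoc]
    exact isSquare_mul_of_isSquare_mul_left (Units.coe_ne_zero u) hεK husq
  calc #D ≤ _ := card_le_card hcover
    _ ≤ #E * b := card_biUnion_le_card_mul _ _ _ fun ε _ =>
        hb _ (filter_subset _ _) (ε * a)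
          (mul_ne_zero (Units.coe_ne_zero ε) (Nat.cast_ne_zero.2 (hD a ha)))
          fun d hd => (mem_filter.1 hd).2
    _ ≤ 2 ^ Units.rank K * b := by gcongr

theorem card_le_mul_card_two_torsion (φ : K →+* ℝ) {D : Finset ℕ} {I : ℕ → (Ideal (𝓞 K))⁰}
    {b : ℕ} (hD : ∀ d ∈ D, d ≠ 0)
    (hI : ∀ d ∈ D, (I d : Ideal (𝓞 K)) ^ 2 = Ideal.span {(d : 𝓞 K)})
    (hb : ∀ S ⊆ D, ∀ c : K, c ≠ 0 → (∀ d ∈ S, IsSquare (c * d)) → #S ≤ b) :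
    #D ≤ 2 ^ Units.rank K * b *
      Nat.card (powMonoidHom 2 : ClassGroup (𝓞 K) →* ClassGroup (𝓞 K)).ker := by
  classical
  set T := (powMonoidHom 2 : ClassGroup (𝓞 K) →* ClassGroup (𝓞 K)).ker
  have hmaps : ∀ d ∈ D, ClassGroup.mk0 (I d) ∈ ({C | C ∈ T} : Finset (ClassGroup (𝓞 K))) := by
    intro d hd
    rw [mem_filter_univ, MonoidHom.mem_ker, powMonoidHom_apply, ← map_pow,
      ClassGroup.mk0_eq_one_iff, SubmonoidClass.coe_pow, hI d hd]
    exact ⟨⟨_, rfl⟩⟩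
  rw [Nat.card_eq_fintype_card, Fintype.card_subtype]
  refine card_le_mul_card_image_of_maps_to hmaps _ fun C _ => ?_
  have hsub : {d ∈ D | ClassGroup.mk0 (I d) = C} ⊆ D := filter_subset _ _
  refine card_le_of_mk0_eq φ (fun d hd => hD d (hsub hd)) (fun d hd => hI d (hsub hd))
    (fun S hS => hb S (hS.trans hsub)) fun d hd e he => ?_
  rw [(mem_filter.1 hd).2, (mem_filter.1 he).2]

end RealEmbedding

section SquareRoot

variable {F K : Type*} [Field F] [Field K] [Algebra F K] {s : K} {n : F}

theorem exists_eq_add_mul_of_mem_adjoin_sqrt (hs : s ^ 2 = algebraMap F K n) {z : K}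
    (hz : z ∈ F⟮s⟯) : ∃ x y : F, z = algebraMap F K x + algebraMap F K y * s := by
  have hint : IsIntegral F s := .of_pow two_pos (hs ▸ isIntegral_algebraMap)
  rw [← mem_toSubalgebra, adjoin_simple_toSubalgebra_of_isAlgebraic hint.isAlgebraic] at hz
  induction hz using Algebra.adjoin_induction with
  | mem x hx => exact ⟨0, 1, by simpa using hx⟩
  | algebraMap r => exact ⟨r, 0, by simp⟩
  | add _ _ _ _ hx hy =>
    obtain ⟨a, b, rfl⟩ := hx
    obtain ⟨c, d, rfl⟩ := hy
    exact ⟨a + c, b + d, by simp only [map_add]; ring⟩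
  | mul _ _ _ _ hx hy =>
    obtain ⟨a, b, rfl⟩ := hx
    obtain ⟨c, d, rfl⟩ := hy
    refine ⟨a * c + b * d * n, a * d + b * c, ?_⟩
    simp only [map_add, map_mul]
    linear_combination algebraMap F K b * algebraMap F K d * hs

theorem isSquare_or_isSquare_mul_of_isSquare_adjoin_sqrt [NeZero (2 : F)]
    (hs : s ^ 2 = algebraMap F K n) {a : F} (ha : IsSquare (algebraMap F F⟮s⟯ a)) :
    IsSquare a ∨ IsSquare (n * a) := by
  obtain ⟨z, hz⟩ := ha
  obtain ⟨x, y, hxy⟩ := exists_eq_add_mul_of_mem_adjoin_sqrt hs z.2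
  have haz : algebraMap F K a = (algebraMap F K x + algebraMap F K y * s) ^ 2 := by
    simpa [← hxy, pow_two] using congrArg (algebraMap F⟮s⟯ K) hz
  have hinj := (algebraMap F K).injective
  by_cases hrange : ∃ r, algebraMap F K r = s
  · obtain ⟨r, rfl⟩ := hrange
    exact .inl ⟨x + y * r, hinj (by simp only [haz, map_add, map_mul]; ring)⟩
  have hlin : algebraMap F K (2 * x * y) * s = algebraMap F K (a - x ^ 2 - n * y ^ 2) := by
    simp only [map_sub, map_mul, map_pow, map_ofNat]
    linear_combination -haz - algebraMap F K y ^ 2 * hs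
  have hxy0 : 2 * x * y = 0 := by
    by_contra h
    refine hrange ⟨(a - x ^ 2 - n * y ^ 2) / (2 * x * y), ?_⟩
    rw [map_div₀, ← hlin, mul_div_cancel_left₀ _ (by simpa using h)]
  have hrat : a - x ^ 2 - n * y ^ 2 = 0 := hinj (by rw [← hlin, hxy0, map_zero, zero_mul])
  have hx_or_hy : x = 0 ∨ y = 0 := by simpa [two_ne_zero] using hxy0
  rcases hx_or_hy with rfl | rfl
  · exact .inr ⟨n * y, by linear_combination n * hrat⟩
  · exact .inl ⟨x, by linear_combination hrat⟩

end SquareRoot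

namespace realQuadField

variable {n : ℕ}

theorem finrank_le_two (n : ℕ) : Module.finrank ℚ (realQuadField n) ≤ 2 := by
  have hroot : Polynomial.aeval √(n : ℝ) (Polynomial.X ^ 2 - Polynomial.C (n : ℚ)) = 0 := by
    simp
  have hmonic := Polynomial.monic_X_pow_sub_C (n : ℚ) two_ne_zero
  rw [adjoin.finrank ⟨_, hmonic, hroot⟩, ← Polynomial.natDegree_X_pow_sub_C (n := 2) (r := (n : ℚ))]
  exact Polynomial.natDegree_le_of_dvd (minpoly.dvd ℚ _ hroot) hmonic.ne_zero

theorem isSquare_or_isSquare_mul_of_isSquare_natCast {a : ℕ}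
    (ha : IsSquare (a : realQuadField n)) : IsSquare a ∨ IsSquare (n * a) := by
  have hs : √(n : ℝ) ^ 2 = algebraMap ℚ ℝ n := by simp
  have h := isSquare_or_isSquare_mul_of_isSquare_adjoin_sqrt hs (a := (a : ℚ)) (by simpa using ha)
  exact_mod_cast h

theorem card_le_two_of_isSquare_mul (hn : n ≠ 0) {D : Finset ℕ} (hD : ∀ d ∈ D, Squarefree d)
    {c : realQuadField n} (hc : c ≠ 0) (h : ∀ d ∈ D, IsSquare (c * d)) : #D ≤ 2 := by
  have isSquare_mul_mul : ∀ a ∈ D, ∀ b ∈ D, a ≠ b → IsSquare (n * (a * b)) := by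
    intro a ha b hb hab
    have hsq := isSquare_mul_of_isSquare_mul_left hc (h a ha) (h b hb)
    rw [← Nat.cast_mul] at hsq
    exact (isSquare_or_isSquare_mul_of_isSquare_natCast hsq).resolve_left
      (hab <| eq_of_isSquare_mul_of_squarefree (hD a ha) (hD b hb) ·)
  by_contra! hcard
  obtain ⟨a, ha, b, hb, e, he, hab, hae, hbe⟩ := two_lt_card.1 hcard
  have hsq : IsSquare ((b : ℚ) * e) := by
    have hna : ((n * a : ℕ) : ℚ) ≠ 0 := Nat.cast_ne_zero.2 (mul_ne_zero hn (hD a ha).ne_zero)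
    apply isSquare_mul_of_isSquare_mul_left hna
    · exact_mod_cast mul_assoc n a b ▸ isSquare_mul_mul a ha b hb hab
    · exact_mod_cast mul_assoc n a e ▸ isSquare_mul_mul a ha e he hae
  exact hbe (eq_of_isSquare_mul_of_squarefree (hD b hb) (hD e he) (by exact_mod_cast hsq))

theorem exists_sq_eq_natCast (n : ℕ) : ∃ θ : 𝓞 (realQuadField n), θ ^ 2 = n := by
  let s : realQuadField n := ⟨√(n : ℝ), mem_adjoin_simple_self ℚ _⟩
  have hs : s ^ 2 = n := Subtype.ext (by simp [s])
  have hint : IsIntegral ℤ s := .of_pow two_pos (hs ▸ isIntegral_natCast n)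
  let θ : 𝓞 (realQuadField n) := ⟨s, hint⟩
  refine ⟨θ, RingOfIntegers.coe_injective ?_⟩
  rw [map_pow, map_natCast]
  exact hs

theorem exists_ideal_sq_eq_span {a c : ℕ} (ha : a ≠ 0) (hn : n = a * c) (hac : a.Coprime c) :
    ∃ I : (Ideal (𝓞 (realQuadField n)))⁰,
      (I : Ideal (𝓞 (realQuadField n))) ^ 2 = Ideal.span {(a : 𝓞 (realQuadField n))} := by
  obtain ⟨θ, hθ⟩ := exists_sq_eq_natCast n
  replace hθ : θ ^ 2 = a * c := by rw [hθ, ← Nat.cast_mul, ← hn]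
  have hsq := span_pair_sq_eq_span_singleton hθ hac.cast
  refine ⟨⟨Ideal.span {(a : 𝓞 (realQuadField n)), θ}, mem_nonZeroDivisors_of_ne_zero ?_⟩, hsq⟩
  rw [← pow_ne_zero_iff two_ne_zero, hsq]
  simpa using ha

end realQuadField

theorem two_pow_dvd_quadClassNumber {c m t : ℕ} (hc : c ≠ 0) (hm : Squarefree m)
    (hcm : c.Coprime m) (ht : t + 2 ≤ #m.primeFactors) : 2 ^ t ∣ quadClassNumber (c * m) := by
  have hideal : ∀ d ∈ m.divisors, ∃ I : (Ideal (𝓞 (realQuadField (c * m))))⁰,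
      (I : Ideal (𝓞 (realQuadField (c * m)))) ^ 2 = Ideal.span {(d : 𝓞 _)} := by
    intro d hd
    obtain ⟨e, rfl⟩ := Nat.dvd_of_mem_divisors hd
    exact realQuadField.exists_ideal_sq_eq_span (Nat.pos_of_mem_divisors hd).ne'
      (mul_left_comm c d e)
      (hcm.coprime_mul_right_right.symm.mul_right (Nat.coprime_of_squarefree_mul hm))
  choose! I hI using hideal
  have hcount := card_le_mul_card_two_torsion (realQuadField (c * m)).val.toRingHom
    (fun d hd => (Nat.pos_of_mem_divisors hd).ne') hI
    fun D hD _ hx hsq => realQuadField.card_le_two_of_isSquare_mul (mul_ne_zero hc hm.ne_zero)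
      (fun d hd => hm.squarefree_of_dvd (Nat.dvd_of_mem_divisors (hD hd))) hx hsq
  have hrank : Units.rank (realQuadField (c * m)) ≤ 1 :=
    Nat.le_of_lt_succ (units_rank_lt_finrank.trans_le (realQuadField.finrank_le_two _))
  rw [quadClassNumber, classNumber, ← Nat.card_eq_fintype_card]
  refine pow_dvd_card_of_pow_le_card_ker (Nat.le_of_mul_le_mul_left ?_ four_pos)
  calc 4 * 2 ^ t = 2 ^ (t + 2) := by ring
    _ ≤ #m.divisors := by
      rw [card_divisors_of_squarefree hm]
      exact Nat.pow_le_pow_right two_pos ht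
    _ ≤ _ := hcount
    _ ≤ 2 ^ 1 * 2 * _ := by gcongr; exact one_le_two

theorem theorem5p4 (k : ℕ) (hk : 1 ≤ k) (M : ℝ) (hM : 0 < M) :
    {d : ℕ | 0 < d ∧ Squarefree d ∧ ∀ j : ℕ, 1 ≤ j → j ≤ k →
        ¬ IsSquare (j * d) ∧ M < (quadClassNumber (j * d) : ℝ)}.Infinite ∧
    ∀ (t : ℕ) (S : Finset ℕ), S.card = t + 2 → (∀ p ∈ S, p.Prime ∧ k < p) →
      M < (2 : ℝ) ^ t →
      Squarefree (∏ p ∈ S, p) ∧ ∀ j : ℕ, 1 ≤ j → j ≤ k →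
        ¬ IsSquare (j * ∏ p ∈ S, p) ∧
        2 ^ t ∣ quadClassNumber (j * ∏ p ∈ S, p) ∧
        M < (quadClassNumber (j * ∏ p ∈ S, p) : ℝ) := by
  refine (and_iff_right_of_imp fun hprod => ?_).2 fun t S hcard hS hMt => ?_
  · refine Set.infinite_of_forall_exists_gt fun N => ?_
    obtain ⟨t, ht⟩ := pow_unbounded_of_one_lt M one_lt_two
    obtain ⟨S, hcard, hS⟩ := exists_primes_gt (max k N) (t + 2)
    obtain ⟨hsf, h⟩ := hprod t S hcard
      (fun p hp => ⟨(hS p hp).1, (le_max_left k N).trans_lt (hS p hp).2⟩) ht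
    have hpos := Nat.pos_of_ne_zero hsf.ne_zero
    obtain ⟨p, hp⟩ : S.Nonempty := card_pos.1 (by omega)
    refine ⟨_, ⟨hpos, hsf, fun j hj hjk => ⟨(h j hj hjk).1, (h j hj hjk).2.2⟩⟩, ?_⟩
    exact (max_lt_iff.1 (hS p hp).2).2.trans_le (Nat.le_of_dvd hpos (dvd_prod_of_mem _ hp))
  · have hprime : ∀ p ∈ S, p.Prime := fun p hp => (hS p hp).1
    have hsf := squarefree_prod_of_forall_prime hprime
    have hω : #(∏ p ∈ S, p).primeFactors = t + 2 := by rw [Nat.primeFactors_prod hprime, hcard]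
    refine ⟨hsf, fun j hj hjk => ?_⟩
    have hcop := coprime_prod_of_forall_lt_prime (Nat.ne_of_gt hj)
      fun p hp => ⟨hprime p hp, hjk.trans_lt (hS p hp).2⟩
    have hdvd := two_pow_dvd_quadClassNumber (Nat.ne_of_gt hj) hsf hcop hω.ge
    refine ⟨not_isSquare_mul_of_coprime_of_squarefree hsf ?_ hcop, hdvd, hMt.trans_le ?_⟩
    · intro h
      simp [h] at hω
    · exact_mod_cast Nat.le_of_dvd (classNumber_pos _) hdvd
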